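/- Let $N$ be a natural number, let $\delta\in\left(-\frac{2}{3\sqrt3},\frac{2}{3\sqrt3}\right)$, and let $z_1(\delta)<-\frac1{\sqrt3}<z_2(\delta)<\frac1{\sqrt3}<z_3(\delta)$ be the three real roots of the polynomial $f_\delta(t)=t-t^3-\delta$. Let $u\in L^3_{\mathrm{loc}}(\mathbb R^N)$ be a real-valued distributional solution of $$-\Delta u=u-u^3-\delta\quad\text{in }\mathbb R^N,$$ that is, $$-\int_{\mathbb R^N}u\,\Delta\varphi\,dx=\int_{\mathbb R^N}(u-u^3-\delta)\,\varphi\,dx\qquad\text{for every }\varphi\in C_c^\infty(\mathbb R^N).$$ Then $z_1(\delta)\le u(x)\le z_3(\delta)$ for almost every $x\in\mathbb R^N$. -/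

import Mathlib

open MeasureTheory Set
open scoped ContDiff Laplacian

/-- The nonlinearity `f_δ(t) = t - t³ - δ`. -/
def cahnHilliardNonlinearity (δ t : ℝ) : ℝ := t - t ^ 3 - δ

/-- The set of real roots of `f_δ`. -/
def rootSetCH (δ : ℝ) : Set ℝ := {t : ℝ | cahnHilliardNonlinearity δ t = 0}

/-- `z₁(δ)`, the smallest real root of `f_δ`. -/
noncomputable def z₁ (δ : ℝ) : ℝ := sInf (rootSetCH δ)

/-- `z₃(δ)`, the largest real root of `f_δ`. -/
noncomputable def z₃ (δ : ℝ) : ℝ := sSup (rootSetCH δ)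

/-- `u ∈ L^p_loc(ℝ^N)`: `u` is in `L^p(K)` for every compact `K`. -/
def MemLpLoc {N : ℕ} (u : EuclideanSpace ℝ (Fin N) → ℝ) (p : ENNReal) : Prop :=
  ∀ K : Set (EuclideanSpace ℝ (Fin N)), IsCompact K → MemLp u p (volume.restrict K)

/-- `u` solves `-Δu = u - u³ - δ` in `𝓓'(ℝ^N)`. For `u ∈ L³_loc(ℝ^N)` both integrands are
integrable for every test function `φ ∈ C_c^∞(ℝ^N)`. -/
def IsDistributionalSolution {N : ℕ} (δ : ℝ) (u : EuclideanSpace ℝ (Fin N) → ℝ) : Prop :=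
  ∀ φ : EuclideanSpace ℝ (Fin N) → ℝ, ContDiff ℝ ∞ φ → HasCompactSupport φ →
    - ∫ x, u x * (Δ φ) x = ∫ x, cahnHilliardNonlinearity δ (u x) * φ x

/-- For `|δ| < 2/(3√3)` the function `f_δ` has exactly three real roots, separated by `±1/√3`;
the outer two are `z₁ δ` and `z₃ δ`. -/
theorem roots_cahnHilliard (δ : ℝ) (hδ : δ ∈ Ioo (-(2 / (3 * √3))) (2 / (3 * √3))) :
    ∃ z₂ : ℝ, z₁ δ < -(1 / √3) ∧ -(1 / √3) < z₂ ∧ z₂ < 1 / √3 ∧ 1 / √3 < z₃ δ ∧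
      rootSetCH δ = {z₁ δ, z₂, z₃ δ} := by
  obtain ⟨h1, h2⟩ := hδ
  have h3 : (0 : ℝ) < √3 := by positivity
  have hsq : √3 ^ 2 = 3 := Real.sq_sqrt (by norm_num)
  set s : ℝ := 1 / √3 with hs
  have hs0 : 0 < s := by positivity
  have hs2 : s ^ 2 = 1 / 3 := by rw [hs, div_pow, hsq]; norm_num
  have hs3 : 2 / (3 * √3) = 2 / 3 * s := by rw [hs]; field_simp
  have hs1 : s < 1 := by nlinarith
  rw [hs3] at h1 h2
  have hc : Continuous (cahnHilliardNonlinearity δ) := by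
    unfold cahnHilliardNonlinearity; fun_prop
  have e1 : 0 < cahnHilliardNonlinearity δ (-2) := by
    unfold cahnHilliardNonlinearity; linarith
  have e2 : cahnHilliardNonlinearity δ (-s) < 0 := by
    unfold cahnHilliardNonlinearity; nlinarith
  have e3 : 0 < cahnHilliardNonlinearity δ s := by
    unfold cahnHilliardNonlinearity; nlinarith
  have e4 : cahnHilliardNonlinearity δ 2 < 0 := by
    unfold cahnHilliardNonlinearity; linarith
  obtain ⟨a, ⟨-, ha⟩, fa⟩ :=
    intermediate_value_Ioo' (by linarith : (-2 : ℝ) ≤ -s) hc.continuousOn ⟨e2, e1⟩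
  obtain ⟨b, ⟨hb, hb'⟩, fb⟩ :=
    intermediate_value_Ioo (by linarith : -s ≤ s) hc.continuousOn ⟨e2, e3⟩
  obtain ⟨c, ⟨hc', -⟩, fc⟩ :=
    intermediate_value_Ioo' (by linarith : s ≤ (2 : ℝ)) hc.continuousOn ⟨e4, e3⟩
  have key : rootSetCH δ = {a, b, c} := by
    have q : ∀ x y : ℝ, cahnHilliardNonlinearity δ x = 0 → cahnHilliardNonlinearity δ y = 0 →
        x ≠ y → x ^ 2 + x * y + y ^ 2 = 1 := by
      intro x y hx hy hxy
      unfold cahnHilliardNonlinearity at hx hy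
      apply mul_left_cancel₀ (sub_ne_zero.2 hxy)
      linarith
    have hab := q a b fa fb (by linarith)
    have hac := q a c fa fc (by linarith)
    have hsum : a + b + c = 0 := by
      apply mul_left_cancel₀ (sub_ne_zero.2 (show b ≠ c by linarith))
      linarith
    ext t
    simp only [rootSetCH, mem_ofPred_eq, mem_insert_iff, mem_singleton_iff]
    constructor
    · intro ft
      by_contra! hne
      have hta := q t a ft fa hne.1
      have htb := q t b ft fb hne.2.1
      have : t + a + b = 0 := by
        apply mul_left_cancel₀ (sub_ne_zero.2 (show a ≠ b by linarith))
        linarith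
      exact hne.2.2 (by linarith)
    · rintro (rfl | rfl | rfl) <;> assumption
  have hz1 : z₁ δ = a := by
    rw [z₁, key]
    refine IsLeast.csInf_eq ⟨by simp, ?_⟩
    rintro x (rfl | rfl | rfl) <;> linarith
  have hz3 : z₃ δ = c := by
    rw [z₃, key]
    refine IsGreatest.csSup_eq ⟨by simp, ?_⟩
    rintro x (rfl | rfl | rfl) <;> linarith
  exact ⟨b, by rw [hz1]; exact ha, hb, hb', by rw [hz3]; exact hc', by rw [hz1, hz3]; exact key⟩

/-! The cubic term forbids `u` from exceeding `z₃`: entire solutions of `Δ v ≥ v³` with `v ≥ 0`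
vanish, with no assumption at infinity (Keller–Osserman). With `F = u³ - u + δ`, the equation reads
`Δ u = F`, and above the largest root `F ≥ (u - z₃)³`. Formally `v = (u - z₃)⁺` then satisfies `Δ v
≥ v³`, so `v = 0`. The lower bound is the upper bound for `-u`, which solves the equation with `-δ`.

Since `u` is only a distributional solution, two regularizations intervene. Kato's inequality
(`integral_deriv_mul_le_integral_comp_mul_laplacian`) is proved by mollifying `u` and passing to the
limit. The positive part is replaced by the convex `C²` function `softPos`, which satisfies `softPos
s ^ 3 ≤ softPosDeriv s * s ^ 3` for `s ≥ 0` and so keeps the cubic inequality with constant one. The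
resulting weak inequality is then mollified again: by Jensen's inequality, the mollifications of `v`
satisfy `Δ v ≥ v³` classically, hence vanish by `eq_zero_of_pow_three_le_laplacian`, and so does
their almost everywhere limit. -/

section

open Filter Topology InnerProductSpace Module
open scoped Convolution

/-! ### Calculus of the Laplacian: chain rule, Green's identity, convolution -/

section Laplacian

theorem ContDiff.fderiv_apply_const {E : Type*} [NormedAddCommGroup E] [NormedSpace ℝ E]
    {f : E → ℝ} {n m : WithTop ℕ∞} (hf : ContDiff ℝ n f)
    (hmn : m + 1 ≤ n) (v : E) : ContDiff ℝ m fun y => fderiv ℝ f y v :=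
  (hf.fderiv_right hmn).clm_apply contDiff_const

theorem MeasureTheory.LocallyIntegrable.integrable_mul_of_hasCompactSupport
    {E : Type*} [NormedAddCommGroup E] [MeasurableSpace E] [BorelSpace E] {μ : Measure E}
    {f g : E → ℝ}
    (hf : LocallyIntegrable f μ) (hg : Continuous g) (hgc : HasCompactSupport g) :
    Integrable (fun x => f x * g x) μ := by
  simpa [smul_eq_mul, mul_comm] using hf.integrable_smul_left_of_hasCompactSupport hg hgc

variable {E : Type*} [NormedAddCommGroup E] [InnerProductSpace ℝ E] [FiniteDimensional ℝ E]

/-- The Laplacian of a `C²` function as a sum of iterated directional derivatives. -/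
theorem laplacian_eq_sum_fderiv_fderiv {f : E → ℝ} {x : E} (hf : ContDiffAt ℝ 2 f x) :
    (Δ f) x = ∑ i, fderiv ℝ (fun y => fderiv ℝ f y (stdOrthonormalBasis ℝ E i)) x
      (stdOrthonormalBasis ℝ E i) := by
  have hd : DifferentiableAt ℝ (fderiv ℝ f) x :=
    (hf.fderiv_right (m := 1) (by norm_num)).differentiableAt (by norm_num)
  rw [laplacian_eq_iteratedFDeriv_stdOrthonormalBasis]
  refine Finset.sum_congr rfl fun i _ => ?_
  rw [iteratedFDeriv_two_apply, fderiv_clm_apply hd (by fun_prop)]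
  simp

theorem ContDiff.continuous_laplacian {f : E → ℝ} (hf : ContDiff ℝ 2 f) :
    Continuous (Δ f) := by
  have : Δ f = fun x => ∑ i, fderiv ℝ (fun y => fderiv ℝ f y (stdOrthonormalBasis ℝ E i)) x
      (stdOrthonormalBasis ℝ E i) := funext fun x => laplacian_eq_sum_fderiv_fderiv hf.contDiffAt
  rw [this]
  refine continuous_finsetSum _ fun i _ => ?_
  exact ((hf.fderiv_apply_const (m := 1) (by norm_num) _).fderiv_apply_const
    (m := 0) (by norm_num) _).continuous

theorem HasCompactSupport.laplacian {f : E → ℝ} (hf : HasCompactSupport f) :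
    HasCompactSupport (Δ f) := by
  refine hf.mono' (fun x hx => ?_)
  by_contra hx'
  apply hx
  have h0 : f =ᶠ[𝓝 x] fun _ => (0 : ℝ) := notMem_tsupport_iff_eventuallyEq.1 hx'
  rw [(laplacian_congr_nhds h0).eq_of_nhds]
  simp

/-- Kato's pointwise inequality for a convex function of a `C²` function. -/
theorem mul_laplacian_le_laplacian_comp {w : E → ℝ} {Φ Φ' Φ'' : ℝ → ℝ} (hw : ContDiff ℝ 2 w)
    (hΦ : ContDiff ℝ 2 Φ) (h1 : ∀ t, HasDerivAt Φ (Φ' t) t) (h2 : ∀ t, HasDerivAt Φ' (Φ'' t) t)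
    (h3 : ∀ t, 0 ≤ Φ'' t) (x : E) :
    Φ' (w x) * (Δ w) x ≤ (Δ (fun y => Φ (w y))) x := by
  have hc : ContDiff ℝ 2 fun y => Φ (w y) := hΦ.comp hw
  rw [laplacian_eq_sum_fderiv_fderiv hw.contDiffAt, laplacian_eq_sum_fderiv_fderiv hc.contDiffAt,
    Finset.mul_sum]
  refine Finset.sum_le_sum fun i _ => ?_
  set e := stdOrthonormalBasis ℝ E i
  have hwd : Differentiable ℝ w := hw.differentiable (by norm_num)
  have hwe : Differentiable ℝ fun y => fderiv ℝ w y e :=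
    (hw.fderiv_apply_const (m := 1) (by norm_num) e).differentiable (by norm_num)
  have e1 : (fun y => fderiv ℝ (fun y => Φ (w y)) y e) = fun y => Φ' (w y) * fderiv ℝ w y e := by
    funext y
    have := ((h1 (w y)).comp_hasFDerivAt y (hwd y).hasFDerivAt).fderiv
    simp only [Function.comp_def] at this
    rw [this]; simp
  have e2 : HasFDerivAt (fun y => Φ' (w y)) (Φ'' (w x) • fderiv ℝ w x) x :=
    (h2 (w x)).comp_hasFDerivAt x (hwd x).hasFDerivAt
  rw [e1, (e2.fun_mul (hwe x).hasFDerivAt).fderiv]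
  simp only [add_apply, smul_apply, smul_eq_mul]
  -- By the chain rule the two sides differ by `Φ''(w) (∂ₑw)²`, which convexity makes nonnegative.
  have := mul_nonneg (h3 (w x)) (mul_self_nonneg (fderiv ℝ w x e))
  nlinarith

theorem laplacian_comp_const_sub {f : E → ℝ} (hf : ContDiff ℝ 2 f) (x y : E) :
    (Δ (fun t => f (x - t))) y = (Δ f) (x - y) := by
  have key : ∀ {g : E → ℝ}, Differentiable ℝ g → ∀ v t,
      fderiv ℝ (fun t => g (x - t)) t v = - fderiv ℝ g (x - t) v := by
    intro g hg v t
    have h := (hg (x - t)).hasFDerivAt.comp t ((hasFDerivAt_id t).const_sub x)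
    simp only [Function.comp_def] at h
    rw [h.fderiv]; simp
  have hc : ContDiff ℝ 2 fun t => f (x - t) := hf.comp (contDiff_const.sub contDiff_id)
  rw [laplacian_eq_sum_fderiv_fderiv hf.contDiffAt, laplacian_eq_sum_fderiv_fderiv hc.contDiffAt]
  refine Finset.sum_congr rfl fun i _ => ?_
  set e := stdOrthonormalBasis ℝ E i
  have hfe : Differentiable ℝ fun y => fderiv ℝ f y e :=
    (hf.fderiv_apply_const (m := 1) (by norm_num) e).differentiable (by norm_num)
  simp_rw [key (hf.differentiable (by norm_num)) e]
  rw [fderiv_fun_neg, neg_apply, key hfe, neg_neg]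

variable [MeasurableSpace E] [BorelSpace E] {μ : Measure E}

variable [μ.IsAddHaarMeasure]

/-- Green's identity against a compactly supported function. -/
theorem integral_mul_laplacian_eq {v φ : E → ℝ} (hv : ContDiff ℝ 2 v) (hφ : ContDiff ℝ 2 φ)
    (hc : HasCompactSupport φ) :
    ∫ x, v x * (Δ φ) x ∂μ = ∫ x, (Δ v) x * φ x ∂μ := by
  have A : ∀ {f g : E → ℝ}, ContDiff ℝ 1 f → ContDiff ℝ 1 g → HasCompactSupport g → ∀ e : E,
      ∫ x, f x * fderiv ℝ g x e ∂μ = - ∫ x, fderiv ℝ f x e * g x ∂μ := by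
    intro f g hf hg hgc e
    have cf := (hf.fderiv_apply_const (m := 0) (by norm_num) e).continuous
    have cg := (hg.fderiv_apply_const (m := 0) (by norm_num) e).continuous
    refine integral_mul_fderiv_eq_neg_fderiv_mul_of_integrable ?_ ?_ ?_
      (fun x _ => hf.differentiable (by norm_num) x) (fun x _ => hg.differentiable (by norm_num) x)
    · exact cf.locallyIntegrable.integrable_mul_of_hasCompactSupport hg.continuous hgc
    · exact hf.continuous.locallyIntegrable.integrable_mul_of_hasCompactSupport cg
        (hgc.fderiv_apply ℝ e)
    · exact hf.continuous.locallyIntegrable.integrable_mul_of_hasCompactSupport hg.continuous hgc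
  have cont2 : ∀ {f : E → ℝ}, ContDiff ℝ 2 f → ∀ e : E,
      Continuous fun x => fderiv ℝ (fun y => fderiv ℝ f y e) x e := fun hf e =>
    ((hf.fderiv_apply_const (m := 1) (by norm_num) e).fderiv_apply_const
      (m := 0) (by norm_num) e).continuous
  simp_rw [fun x => laplacian_eq_sum_fderiv_fderiv (hφ.contDiffAt (x := x)),
    fun x => laplacian_eq_sum_fderiv_fderiv (hv.contDiffAt (x := x)), Finset.mul_sum,
    Finset.sum_mul]
  rw [integral_finsetSum, integral_finsetSum]
  · refine Finset.sum_congr rfl fun i _ => ?_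
    set e := stdOrthonormalBasis ℝ E i
    have hve := hv.fderiv_apply_const (m := 1) (by norm_num) e
    have hφe := hφ.fderiv_apply_const (m := 1) (by norm_num) e
    rw [A (hv.of_le (by norm_num)) hφe (hc.fderiv_apply ℝ e) e,
      A hve (hφ.of_le (by norm_num)) hc e, neg_neg]
  · exact fun i _ => (cont2 hv _).locallyIntegrable.integrable_mul_of_hasCompactSupport
      hφ.continuous hc
  · exact fun i _ => hv.continuous.locallyIntegrable.integrable_mul_of_hasCompactSupport
      (cont2 hφ _) ((hc.fderiv_apply ℝ _).fderiv_apply ℝ _)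

/-- The Laplacian of a convolution with a test function. -/
theorem laplacian_convolution {g ρ : E → ℝ} (hg : LocallyIntegrable g μ) (hρ : ContDiff ℝ 2 ρ)
    (hc : HasCompactSupport ρ) (x : E) :
    (Δ (g ⋆[ContinuousLinearMap.lsmul ℝ ℝ, μ] ρ)) x = ∫ t, g t * (Δ (fun y => ρ (x - y))) t ∂μ := by
  have A : ∀ {f : E → ℝ}, ContDiff ℝ 1 f → HasCompactSupport f → ∀ e y : E,
      fderiv ℝ (g ⋆[ContinuousLinearMap.lsmul ℝ ℝ, μ] f) y e
        = (g ⋆[ContinuousLinearMap.lsmul ℝ ℝ, μ] fun z => fderiv ℝ f z e) y := by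
    intro f hf hfc e y
    rw [(hfc.hasFDerivAt_convolution_right _ hg hf y).fderiv]
    exact convolution_precompR_apply _ hg (hfc.fderiv ℝ) (hf.continuous_fderiv (by norm_num)) y e
  have hC : ContDiff ℝ 2 (g ⋆[ContinuousLinearMap.lsmul ℝ ℝ, μ] ρ) :=
    hc.contDiff_convolution_right (n := 2) _ hg hρ
  rw [laplacian_eq_sum_fderiv_fderiv hC.contDiffAt]
  simp_rw [laplacian_comp_const_sub hρ, laplacian_eq_sum_fderiv_fderiv hρ.contDiffAt,
    Finset.mul_sum]
  rw [integral_finsetSum]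
  · refine Finset.sum_congr rfl fun i _ => ?_
    set e := stdOrthonormalBasis ℝ E i
    simp_rw [A (hρ.of_le (by norm_num)) hc e]
    rw [A (hρ.fderiv_apply_const (m := 1) (by norm_num) e) (hc.fderiv_apply ℝ e) e]
    rfl
  · intro i _
    have hcont := ((hρ.fderiv_apply_const (m := 1) (by norm_num)
      (stdOrthonormalBasis ℝ E i)).fderiv_apply_const (m := 0) (by norm_num)
      (stdOrthonormalBasis ℝ E i)).continuous
    exact (((hc.fderiv_apply ℝ _).fderiv_apply ℝ _).convolutionExists_right
      (ContinuousLinearMap.lsmul ℝ ℝ) hg hcont x)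

end Laplacian

/-! ### The Keller–Osserman estimate for classical solutions -/

section KellerOsserman

/-- Second order necessary condition for a local maximum. -/
theorem IsLocalMax.deriv_deriv_nonpos {f : ℝ → ℝ} {a : ℝ} (h : IsLocalMax f a)
    (hc : ContinuousAt f a) : deriv (deriv f) a ≤ 0 := by
  by_contra! hpos
  -- A positive second derivative would make `a` also a local minimum, so `f` would be constant near
  -- `a`.
  have hmin : IsLocalMin f a := isLocalMin_of_deriv_deriv_pos hpos h.deriv_eq_zero hc
  have heq : f =ᶠ[𝓝 a] fun _ => f a := by
    filter_upwards [h, hmin] with x h1 h2 using le_antisymm h1 h2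
  have := heq.deriv.deriv_eq
  simp at this
  linarith

variable {E : Type*} [NormedAddCommGroup E] [InnerProductSpace ℝ E]

/-- At a maximum point of `v · (R² - |x - y|²)`, the second derivatives of `v` are controlled. -/
theorem fderiv_fderiv_mul_sq_le_of_isLocalMax {v : E → ℝ} (hv : ContDiff ℝ 2 v) {x y e : E}
    (he : ‖e‖ = 1) {R : ℝ} (hs : 0 < R ^ 2 - ‖x - y‖ ^ 2)
    (hmax : IsLocalMax (fun z => v z * (R ^ 2 - ‖z - y‖ ^ 2)) x) :
    fderiv ℝ (fun z => fderiv ℝ v z e) x e * (R ^ 2 - ‖x - y‖ ^ 2) ^ 2 ≤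
      v x * (2 * (R ^ 2 - ‖x - y‖ ^ 2) + 8 * ⟪e, x - y⟫_ℝ ^ 2) := by
  set c := ⟪e, x - y⟫_ℝ with hcdef
  set s := R ^ 2 - ‖x - y‖ ^ 2 with hsdef
  -- On the line through `x` in direction `e` the weight is a quadratic polynomial, so the
  -- one-variable maximum conditions apply.
  have hsq : ∀ t : ℝ, R ^ 2 - ‖x + t • e - y‖ ^ 2 = s - 2 * c * t - t ^ 2 := by
    intro t
    have : x + t • e - y = (x - y) + t • e := by abel
    rw [this, norm_add_sq_real, inner_smul_right, norm_smul, he, real_inner_comm, ← hcdef, hsdef]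
    simp only [Real.norm_eq_abs, mul_one, sq_abs]
    ring
  have hline : ∀ t : ℝ, HasDerivAt (fun t : ℝ => x + t • e) e t := by
    intro t
    simpa using ((hasDerivAt_id t).smul_const e).const_add x
  have hd1 : ∀ t : ℝ, HasDerivAt (fun t : ℝ => v (x + t • e)) (fderiv ℝ v (x + t • e) e) t :=
    fun t => ((hv.differentiable (by norm_num)) _).hasFDerivAt.comp_hasDerivAt t (hline t)
  have hd2 : ∀ t : ℝ, HasDerivAt (fun t : ℝ => fderiv ℝ v (x + t • e) e)
      (fderiv ℝ (fun z => fderiv ℝ v z e) (x + t • e) e) t := fun t =>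
    (((hv.fderiv_apply_const (m := 1) (by norm_num) e).differentiable
      (by norm_num)) _).hasFDerivAt.comp_hasDerivAt t (hline t)
  have hq : ∀ t : ℝ, HasDerivAt (fun t : ℝ => s - 2 * c * t - t ^ 2) (- 2 * c - 2 * t) t := by
    intro t
    have := (((hasDerivAt_id t).const_mul (2 * c)).const_sub s).sub ((hasDerivAt_id t).pow 2)
    exact this.congr_deriv (by simp)
  have hq2 : ∀ t : ℝ, HasDerivAt (fun t : ℝ => - 2 * c - 2 * t) (-2) t := by
    intro t
    have := (((hasDerivAt_id t).const_mul 2)).const_sub (-2 * c)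
    exact this.congr_deriv (by simp)
  set p : ℝ → ℝ := fun t => v (x + t • e) * (s - 2 * c * t - t ^ 2) with hp
  have hp1 : ∀ t, HasDerivAt p (fderiv ℝ v (x + t • e) e * (s - 2 * c * t - t ^ 2) +
      v (x + t • e) * (- 2 * c - 2 * t)) t := fun t => (hd1 t).fun_mul (hq t)
  have hp2 := ((hd2 0).fun_mul (hq 0)).fun_add ((hd1 0).fun_mul (hq2 0))
  have hpmax : IsLocalMax p 0 := by
    have ht : Tendsto (fun t : ℝ => x + t • e) (𝓝 0) (𝓝 x) := by
      have : Continuous fun t : ℝ => x + t • e := by fun_prop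
      simpa using this.tendsto 0
    have := ht.eventually hmax
    filter_upwards [this] with t ht
    simp only [hp]
    rw [← hsq, ← hsq]
    simpa using ht
  have hz := hpmax.deriv_eq_zero
  have hn := hpmax.deriv_deriv_nonpos (hp1 0).continuousAt
  have hderiv : deriv p = fun t => fderiv ℝ v (x + t • e) e * (s - 2 * c * t - t ^ 2) +
      v (x + t • e) * (- 2 * c - 2 * t) := funext fun t => (hp1 t).deriv
  rw [hderiv] at hz hn
  rw [hp2.deriv] at hn
  simp only [zero_smul, add_zero, mul_zero, sub_zero, ne_eq, OfNat.ofNat_ne_zero,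
    not_false_eq_true, zero_pow] at hz hn
  have h1 : fderiv ℝ v x e * s = 2 * c * v x := by linarith
  have h2 : fderiv ℝ (fun z => fderiv ℝ v z e) x e * s - 4 * c * fderiv ℝ v x e - 2 * v x ≤ 0 := by
    linarith
  -- One more factor `s` lets the first-order condition `h1` eliminate the gradient term.
  have h3 := mul_le_mul_of_nonneg_right h2 hs.le
  have h4 : c * (fderiv ℝ v x e * s) = c * (2 * c * v x) := by rw [h1]
  nlinarith

variable [FiniteDimensional ℝ E]

/-- A nonnegative entire `C²` solution of `Δ v ≥ v³` vanishes. -/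
theorem eq_zero_of_pow_three_le_laplacian {v : E → ℝ} (hv : ContDiff ℝ 2 v) (h0 : ∀ x, 0 ≤ v x)
    (hΔ : ∀ x, v x ^ 3 ≤ (Δ v) x) (y : E) : v y = 0 := by
  -- Summing the directional bounds over an orthonormal basis gives `2 * dim * s + 8 * ‖x - y‖²`,
  -- and both `s` and `‖x - y‖²` are at most `R²`.
  set C : ℝ := 2 * finrank ℝ E + 8 with hC
  have hC0 : 0 < C := by positivity
  have bound : ∀ R : ℝ, 0 < R → (v y) ^ 2 * R ^ 2 ≤ C := by
    intro R hR
    have hcont : Continuous fun z => v z * (R ^ 2 - ‖z - y‖ ^ 2) := by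
      have := hv.continuous
      fun_prop
    obtain ⟨x, hx, hmax⟩ := (isCompact_closedBall y R).exists_isMaxOn
      ⟨y, Metric.mem_closedBall_self hR.le⟩ hcont.continuousOn
    have hy : v y * R ^ 2 ≤ v x * (R ^ 2 - ‖x - y‖ ^ 2) := by
      simpa using hmax (Metric.mem_closedBall_self hR.le)
    rw [Metric.mem_closedBall, dist_eq_norm] at hx
    -- If the maximum is attained on the sphere, where the weight vanishes, then `v y = 0` already.
    rcases hx.eq_or_lt with hx | hx
    · rw [hx, sub_self, mul_zero] at hy
      have : v y = 0 := by
        have := h0 y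
        have : 0 < R ^ 2 := by positivity
        nlinarith
      rw [this]; simp; positivity
    have hs : 0 < R ^ 2 - ‖x - y‖ ^ 2 := by nlinarith [norm_nonneg (x - y)]
    have hloc : IsLocalMax (fun z => v z * (R ^ 2 - ‖z - y‖ ^ 2)) x := by
      refine hmax.isLocalMax (mem_of_superset (Metric.isOpen_ball.mem_nhds ?_)
        Metric.ball_subset_closedBall)
      rwa [Metric.mem_ball, dist_eq_norm]
    set s := R ^ 2 - ‖x - y‖ ^ 2 with hsdef
    have hlap : (Δ v) x * s ^ 2 ≤ v x * (2 * finrank ℝ E * s + 8 * ‖x - y‖ ^ 2) := by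
      rw [laplacian_eq_sum_fderiv_fderiv hv.contDiffAt, Finset.sum_mul]
      refine (Finset.sum_le_sum fun i _ => fderiv_fderiv_mul_sq_le_of_isLocalMax hv
        ((stdOrthonormalBasis ℝ E).norm_eq_one i) hs hloc).trans_eq ?_
      rw [← Finset.mul_sum, Finset.sum_add_distrib, ← Finset.mul_sum (a := (8 : ℝ)),
        OrthonormalBasis.sum_sq_inner_right]
      simp
      left; ring
    have hle : 2 * finrank ℝ E * s + 8 * ‖x - y‖ ^ 2 ≤ C * R ^ 2 := by
      have h1 : s ≤ R ^ 2 := by nlinarith [sq_nonneg ‖x - y‖]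
      have h2 : ‖x - y‖ ^ 2 ≤ R ^ 2 := by linarith
      have h3 : (finrank ℝ E : ℝ) * s ≤ finrank ℝ E * R ^ 2 := by gcongr
      rw [hC]; nlinarith
    have hvx : (v x * s) ^ 2 ≤ C * R ^ 2 := by
      rcases (h0 x).eq_or_lt with hz | hz
      · rw [← hz]; simp; positivity
      have h1 : v x * (v x * s) ^ 2 ≤ v x * (C * R ^ 2) := by
        calc v x * (v x * s) ^ 2 = v x ^ 3 * s ^ 2 := by ring
          _ ≤ (Δ v) x * s ^ 2 := by gcongr; exact hΔ x
          _ ≤ _ := hlap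
          _ ≤ _ := by gcongr
      exact le_of_mul_le_mul_left h1 hz
    -- Comparing the center with the maximum point gains `R⁴` on the left against `R²` on the right.
    have h2 : (v y * R ^ 2) ^ 2 ≤ C * R ^ 2 :=
      (pow_le_pow_left₀ (mul_nonneg (h0 y) (by positivity)) hy 2).trans hvx
    have h3 : R ^ 2 * (v y ^ 2 * R ^ 2) ≤ R ^ 2 * C := by linarith
    exact le_of_mul_le_mul_left h3 (by positivity)
  by_contra hne
  have hpos : 0 < v y := lt_of_le_of_ne (h0 y) (Ne.symm hne)
  -- This radius turns the bound into `(C + 1)² ≤ C`, which is absurd.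
  have := bound ((C + 1) / v y) (by positivity)
  rw [div_pow, mul_div_cancel₀ _ (by positivity)] at this
  nlinarith

end KellerOsserman

/-! ### Mollification and its convergence in local `L¹` -/

section Mollification

/-- **Scheffé's lemma**: a sequence of nonnegative functions which converges almost everywhere and
whose integrals converge to the integral of the limit converges in `L¹`. -/
theorem tendsto_integral_abs_sub_of_nonneg {α : Type*} [MeasurableSpace α] {μ : Measure α}
    {f : ℕ → α → ℝ} {g : α → ℝ} (hf : ∀ n, Integrable (f n) μ) (hg : Integrable g μ)
    (hf0 : ∀ n x, 0 ≤ f n x) (hg0 : ∀ x, 0 ≤ g x)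
    (hlim : ∀ᵐ x ∂μ, Tendsto (fun n => f n x) atTop (𝓝 (g x)))
    (hint : Tendsto (fun n => ∫ x, f n x ∂μ) atTop (𝓝 (∫ x, g x ∂μ))) :
    Tendsto (fun n => ∫ x, |f n x - g x| ∂μ) atTop (𝓝 0) := by
  -- Nonnegativity of `f n` puts `(g - f n)⁺` below `g`, so dominated convergence applies to it; the
  -- rest is `|f - g| = 2 (g - f)⁺ + (f - g)`.
  have h1 : Tendsto (fun n => ∫ x, max (g x - f n x) 0 ∂μ) atTop (𝓝 (∫ _, (0 : ℝ) ∂μ)) := by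
    refine tendsto_integral_of_dominated_convergence g
      (fun n => (hg.sub (hf n)).pos_part.aestronglyMeasurable) hg
      (fun n => .of_forall fun x => ?_) ?_
    · rw [Real.norm_eq_abs, abs_of_nonneg (le_max_right _ _)]
      exact max_le (by linarith [hf0 n x]) (hg0 x)
    · filter_upwards [hlim] with x hx
      simpa using ((tendsto_const_nhds (x := g x)).sub hx).max (tendsto_const_nhds (x := (0 : ℝ)))
  have h2 : ∀ n, ∫ x, |f n x - g x| ∂μ
      = 2 * ∫ x, max (g x - f n x) 0 ∂μ + (∫ x, f n x ∂μ - ∫ x, g x ∂μ) := by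
    intro n
    have i1 : Integrable (fun x => 2 * max (g x - f n x) 0) μ :=
      (hg.sub (hf n)).pos_part.const_mul 2
    have i2 : Integrable (fun x => f n x - g x) μ := (hf n).sub hg
    rw [← integral_const_mul, ← integral_sub (hf n) hg, ← integral_add i1 i2]
    refine integral_congr_ae (.of_forall fun x => ?_)
    beta_reduce
    rcases le_total (g x) (f n x) with h | h
    · rw [abs_of_nonneg (by linarith), max_eq_right (by linarith)]; ring
    · rw [abs_of_nonpos (by linarith), max_eq_left (by linarith)]; ring
  simp_rw [h2]
  simpa using (h1.const_mul 2).add (hint.sub_const (∫ x, g x ∂μ))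

variable {E : Type*} [NormedAddCommGroup E] [InnerProductSpace ℝ E] [FiniteDimensional ℝ E]
  [MeasurableSpace E]

variable (E) in
/-- A sequence of bump functions centred at the origin with shrinking supports. -/
noncomputable def shrinkingBump (n : ℕ) : ContDiffBump (0 : E) where
  rIn := 1 / (n + 1) / 2
  rOut := 1 / (n + 1)
  rIn_pos := by positivity
  rIn_lt_rOut := half_lt_self (by positivity)

/-- The `n`-th mollification of `g`. -/
noncomputable def mollify (μ : Measure E) (n : ℕ) (g : E → ℝ) : E → ℝ :=
  g ⋆[ContinuousLinearMap.lsmul ℝ ℝ, μ] (shrinkingBump E n).normed μ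

variable {μ : Measure E}

theorem mollify_apply (n : ℕ) (g : E → ℝ) (x : E) :
    mollify μ n g x = ∫ t, g t * (shrinkingBump E n).normed μ (x - t) ∂μ := rfl

theorem mollify_nonneg {g : E → ℝ} (hg : ∀ x, 0 ≤ g x) (n : ℕ) (x : E) : 0 ≤ mollify μ n g x :=
  integral_nonneg fun t => mul_nonneg (hg t) ((shrinkingBump E n).nonneg_normed _)

variable [BorelSpace E] [μ.IsAddHaarMeasure]

theorem mollify_eq_convolution_left (n : ℕ) (g : E → ℝ) :
    mollify μ n g = (shrinkingBump E n).normed μ ⋆[ContinuousLinearMap.lsmul ℝ ℝ, μ] g := by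
  funext x
  rw [convolution_lsmul_swap, mollify_apply]
  simp_rw [smul_eq_mul, mul_comm]

theorem integrable_mul_shrinkingBump {g : E → ℝ} (hg : LocallyIntegrable g μ) (n : ℕ) (x : E) :
    Integrable (fun t => g t * (shrinkingBump E n).normed μ (x - t)) μ :=
  (shrinkingBump E n).hasCompactSupport_normed.convolutionExists_right
    (ContinuousLinearMap.lsmul ℝ ℝ) hg (shrinkingBump E n).continuous_normed x

theorem contDiff_mollify {g : E → ℝ} (hg : LocallyIntegrable g μ) (n : ℕ) :
    ContDiff ℝ 2 (mollify μ n g) :=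
  (shrinkingBump E n).hasCompactSupport_normed.contDiff_convolution_right (n := 2) _ hg
    (shrinkingBump E n).contDiff_normed

theorem ae_tendsto_mollify {g : E → ℝ} (hg : LocallyIntegrable g μ) :
    ∀ᵐ x ∂μ, Tendsto (fun n => mollify μ n g x) atTop (𝓝 (g x)) := by
  simp_rw [mollify_eq_convolution_left]
  -- The outer radius is always twice the inner one, hence `K = 2`.
  refine ContDiffBump.ae_convolution_tendsto_right_of_locallyIntegrable (K := 2)
    tendsto_one_div_add_atTop_nhds_zero_nat (.of_forall fun n => ?_) hg
  simp only [shrinkingBump]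
  linarith

theorem integrable_mollify {g : E → ℝ} (hg : Integrable g μ) (n : ℕ) :
    Integrable (mollify μ n g) μ :=
  hg.integrable_convolution _ (shrinkingBump E n).integrable_normed

theorem integral_mollify {g : E → ℝ} (hg : Integrable g μ) (n : ℕ) :
    ∫ x, mollify μ n g x ∂μ = ∫ x, g x ∂μ := by
  rw [mollify, integral_convolution _ hg (shrinkingBump E n).integrable_normed,
    ContDiffBump.integral_normed]
  simp

/-- Mollification preserves the integral, so Scheffé's lemma applies to the positive and negative
parts separately. -/
theorem tendsto_integral_abs_mollify_sub {g : E → ℝ} (hg : Integrable g μ) :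
    Tendsto (fun n => ∫ x, |mollify μ n g x - g x| ∂μ) atTop (𝓝 0) := by
  have key : ∀ {f : E → ℝ}, Integrable f μ → (∀ x, 0 ≤ f x) →
      Tendsto (fun n => ∫ x, |mollify μ n f x - f x| ∂μ) atTop (𝓝 0) := fun {f} hf hf0 =>
    tendsto_integral_abs_sub_of_nonneg (integrable_mollify hf) hf (mollify_nonneg hf0) hf0
      (ae_tendsto_mollify hf.locallyIntegrable)
      (by simp_rw [integral_mollify hf]; exact tendsto_const_nhds)
  have hp := hg.pos_part
  have hn := hg.neg_part
  refine squeeze_zero (fun n => integral_nonneg fun x => abs_nonneg _) (fun n => ?_)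
    (by simpa using (key hp fun x => le_max_right _ _).add (key hn fun x => le_max_right _ _))
  have hi : ∀ {f : E → ℝ}, Integrable f μ → Integrable (fun x => |mollify μ n f x - f x|) μ :=
    fun hf => ((integrable_mollify hf n).sub hf).abs
  rw [← integral_add (hi hp) (hi hn)]
  refine integral_mono (hi hg) ((hi hp).add (hi hn)) fun x => ?_
  have e1 : ∀ t, g t = max (g t) 0 - max (-g t) 0 := by
    intro t
    rcases le_total 0 (g t) with h | h
    · rw [max_eq_left h, max_eq_right (by linarith)]; ring
    · rw [max_eq_right h, max_eq_left (by linarith)]; ring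
  have e2 : mollify μ n g x
      = mollify μ n (fun t => max (g t) 0) x - mollify μ n (fun t => max (-g t) 0) x := by
    simp only [mollify_apply]
    rw [← integral_sub (integrable_mul_shrinkingBump hp.locallyIntegrable n x)
      (integrable_mul_shrinkingBump hn.locallyIntegrable n x)]
    refine integral_congr_ae (.of_forall fun t => ?_)
    simp only
    rw [← sub_mul, ← e1]
  have e3 : mollify μ n g x - g x = (mollify μ n (fun t => max (g t) 0) x - max (g x) 0) -
      (mollify μ n (fun t => max (-g t) 0) x - max (-g x) 0) := by
    rw [e2]
    linarith [e1 x]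
  beta_reduce
  rw [e3]
  exact abs_sub _ _

/-- Mollifications of a locally integrable function converge in `L¹` on compact sets. -/
theorem tendsto_setIntegral_abs_mollify_sub {g : E → ℝ} (hg : LocallyIntegrable g μ) {K : Set E}
    (hK : IsCompact K) :
    Tendsto (fun n => ∫ x in K, |mollify μ n g x - g x| ∂μ) atTop (𝓝 0) := by
  -- All bumps have radius at most 1, so on `K` the mollifications only see `g` on `K'`.
  set K' := Metric.cthickening 1 K with hK'
  have hK'c : IsCompact K' := hK.cthickening
  have hgi : Integrable (K'.indicator g) μ :=
    (hg.integrableOn_isCompact hK'c).integrable_indicator hK'c.measurableSet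
  refine squeeze_zero (fun n => integral_nonneg fun x => abs_nonneg _) (fun n => ?_)
    (tendsto_integral_abs_mollify_sub hgi)
  have hi := ((integrable_mollify hgi n).sub hgi).abs
  refine le_trans (le_of_eq ?_)
    (setIntegral_le_integral (s := K) hi (.of_forall fun x => abs_nonneg _))
  refine setIntegral_congr_fun hK.measurableSet fun x hx => ?_
  have hxK' : x ∈ K' := Metric.self_subset_cthickening _ hx
  have : mollify μ n (K'.indicator g) x = mollify μ n g x := by
    simp only [mollify_apply]
    refine integral_congr_ae (.of_forall fun t => ?_)
    by_cases ht : t ∈ K'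
    · simp [ht]
    · have hz : (shrinkingBump E n).normed μ (x - t) = 0 := by
        rw [← Function.notMem_support, ContDiffBump.support_normed_eq, mem_ball_zero_iff, not_lt]
        by_contra! hlt
        refine ht (Metric.mem_cthickening_of_dist_le t x 1 K hx ?_)
        rw [dist_comm, dist_eq_norm]
        refine hlt.le.trans ?_
        change (1 : ℝ) / (n + 1) ≤ 1
        rw [div_le_one (by positivity)]
        linarith [(Nat.cast_nonneg n : (0 : ℝ) ≤ n)]
      simp [hz]
  simp only [this, indicator_of_mem hxK']

end Mollification

/-! ### A convex `C²` replacement for the positive part -/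

section SmoothPositivePart

/-- The condition `h' 0 = 0` makes the one-sided derivatives agree at 0. Both `t - arctan t` and its
derivative `t² / (1 + t²)` meet it, which makes `softPos` of class `C²`. -/
theorem hasDerivAt_comp_max_zero {h h' : ℝ → ℝ} (hh : ∀ t, HasDerivAt h (h' t) t) (h0 : h' 0 = 0)
    (s : ℝ) : HasDerivAt (fun t => h (max t 0)) (h' (max s 0)) s := by
  rcases lt_trichotomy s 0 with hs | rfl | hs
  · rw [max_eq_right hs.le, h0]
    refine (hasDerivAt_const s (h 0)).congr_of_eventuallyEq ?_
    filter_upwards [eventually_lt_nhds hs] with t ht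
    rw [max_eq_right ht.le]
  · rw [max_self, h0, ← hasDerivWithinAt_univ, ← Iic_union_Ici (a := (0 : ℝ))]
    refine HasDerivWithinAt.union ?_ ?_
    · refine (hasDerivWithinAt_const 0 (Iic 0) (h 0)).congr (fun t ht => ?_) (by simp)
      rw [max_eq_right ht]
    · have := (hh 0).hasDerivWithinAt (s := Ici 0)
      rw [h0] at this
      refine this.congr (fun t ht => ?_) (by simp)
      rw [max_eq_left ht]
  · rw [max_eq_left hs.le]
    refine (hh s).congr_of_eventuallyEq ?_
    filter_upwards [eventually_gt_nhds hs] with t ht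
    rw [max_eq_left ht.le]

/-- A convex `C²` substitute for the positive part. -/
noncomputable def softPos (s : ℝ) : ℝ := max s 0 - Real.arctan (max s 0)

/-- The derivative of `softPos`. -/
noncomputable def softPosDeriv (s : ℝ) : ℝ := (max s 0) ^ 2 / (1 + (max s 0) ^ 2)

theorem hasDerivAt_softPos (s : ℝ) : HasDerivAt softPos (softPosDeriv s) s := by
  refine hasDerivAt_comp_max_zero (h := fun t => t - Real.arctan t)
    (h' := fun t => t ^ 2 / (1 + t ^ 2)) (fun t => ?_) (by simp) s
  refine ((hasDerivAt_id t).sub (Real.hasDerivAt_arctan t)).congr_deriv ?_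
  have : 1 + t ^ 2 ≠ 0 := by positivity
  field_simp; ring

theorem hasDerivAt_softPosDeriv (s : ℝ) :
    HasDerivAt softPosDeriv (2 * max s 0 / (1 + (max s 0) ^ 2) ^ 2) s := by
  refine hasDerivAt_comp_max_zero (h := fun t => t ^ 2 / (1 + t ^ 2))
    (h' := fun t => 2 * t / (1 + t ^ 2) ^ 2) (fun t => ?_) (by simp) s
  have hne : 1 + t ^ 2 ≠ 0 := by positivity
  refine ((hasDerivAt_pow 2 t).fun_div ((hasDerivAt_pow 2 t).const_add 1) hne).congr_deriv ?_
  field_simp; simp; ring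

theorem softPosDeriv_nonneg (s : ℝ) : 0 ≤ softPosDeriv s := by
  unfold softPosDeriv; positivity

theorem softPosDeriv_le_one (s : ℝ) : softPosDeriv s ≤ 1 := by
  unfold softPosDeriv
  rw [div_le_one (by positivity)]; linarith

theorem contDiff_softPos : ContDiff ℝ 2 softPos := by
  have h1 : deriv softPos = softPosDeriv := funext fun s => (hasDerivAt_softPos s).deriv
  have h2 : deriv softPosDeriv = fun s => 2 * max s 0 / (1 + (max s 0) ^ 2) ^ 2 :=
    funext fun s => (hasDerivAt_softPosDeriv s).deriv
  rw [show (2 : WithTop ℕ∞) = 1 + 1 by norm_num, contDiff_succ_iff_deriv, h1, contDiff_one_iff_deriv,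
    h2]
  refine ⟨fun s => (hasDerivAt_softPos s).differentiableAt, by simp,
    fun s => (hasDerivAt_softPosDeriv s).differentiableAt, ?_⟩
  exact Continuous.div (by fun_prop) (by fun_prop) fun s => by positivity

theorem abs_softPos_sub_le (a b : ℝ) : |softPos a - softPos b| ≤ |a - b| := by
  have := Convex.norm_image_sub_le_of_norm_hasDerivWithin_le (f := softPos) (f' := softPosDeriv)
    (C := 1) (s := univ) (fun x _ => (hasDerivAt_softPos x).hasDerivWithinAt)
    (fun x _ => by
      rw [Real.norm_eq_abs, abs_of_nonneg (softPosDeriv_nonneg x)]; exact softPosDeriv_le_one x)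
    convex_univ (mem_univ b) (mem_univ a)
  simpa using this

theorem softPos_of_nonpos {s : ℝ} (hs : s ≤ 0) : softPos s = 0 := by
  simp [softPos, max_eq_right hs]

/-- Convexity: the slope of the chord from 0 to `s` is the derivative at an intermediate point, and
the derivative is monotone on the positive axis. -/
theorem softPos_pos_and_le {s : ℝ} (hs : 0 < s) :
    0 < softPos s ∧ softPos s ≤ s * softPosDeriv s := by
  obtain ⟨ξ, ⟨h0, h1⟩, h⟩ := exists_hasDerivAt_eq_slope softPos softPosDeriv hs
    contDiff_softPos.continuous.continuousOn fun x _ => hasDerivAt_softPos x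
  rw [softPos_of_nonpos le_rfl, sub_zero, sub_zero, eq_div_iff hs.ne'] at h
  have hξ : 0 < softPosDeriv ξ := by
    unfold softPosDeriv; rw [max_eq_left h0.le]; positivity
  have hmono : softPosDeriv ξ ≤ softPosDeriv s := by
    unfold softPosDeriv
    rw [max_eq_left h0.le, max_eq_left hs.le, div_le_div_iff₀ (by positivity) (by positivity)]
    nlinarith
  rw [← h]
  exact ⟨by positivity, by nlinarith⟩

theorem softPos_nonneg (s : ℝ) : 0 ≤ softPos s := by
  rcases le_or_gt s 0 with hs | hs
  · rw [softPos_of_nonpos hs]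
  · exact (softPos_pos_and_le hs).1.le

/-- This is how the cubic lower bound survives Kato's inequality: the chord bound costs
`softPosDeriv s ^ 3`, which is at most `softPosDeriv s` because the slope lies in `[0, 1]`. -/
theorem softPos_pow_three_le {s F : ℝ} (h : 0 ≤ s → s ^ 3 ≤ F) :
    softPos s ^ 3 ≤ softPosDeriv s * F := by
  rcases le_or_gt s 0 with hs | hs
  · rw [softPos_of_nonpos hs, softPosDeriv, max_eq_right hs]; simp
  · have h0 := softPosDeriv_nonneg s
    have h1 := softPosDeriv_le_one s
    calc softPos s ^ 3 ≤ (s * softPosDeriv s) ^ 3 :=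
          pow_le_pow_left₀ (softPos_nonneg s) (softPos_pos_and_le hs).2 3
      _ = softPosDeriv s ^ 3 * s ^ 3 := by ring
      _ ≤ softPosDeriv s * s ^ 3 := by
          gcongr
          exact pow_le_of_le_one h0 h1 (by norm_num)
      _ ≤ _ := by gcongr; exact h hs.le

end SmoothPositivePart

/-! ### Kato's inequality and the Liouville theorem for distributional solutions -/

section Kato

variable {E : Type*} [NormedAddCommGroup E] [InnerProductSpace ℝ E] [FiniteDimensional ℝ E]
  [MeasurableSpace E] {μ : Measure E}

theorem contDiff_shrinkingBump_sub (n : ℕ) (x : E) :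
    ContDiff ℝ ∞ fun t => (shrinkingBump E n).normed μ (x - t) :=
  (ContDiffBump.contDiff_normed (n := ⊤) (shrinkingBump E n)).comp (contDiff_const.sub contDiff_id)

variable [BorelSpace E] [μ.IsAddHaarMeasure]

theorem hasCompactSupport_shrinkingBump_sub (n : ℕ) (x : E) :
    HasCompactSupport fun t => (shrinkingBump E n).normed μ (x - t) :=
  (ContDiffBump.hasCompactSupport_normed (μ := μ) (shrinkingBump E n)).comp_homeomorph
    (Homeomorph.subLeft x)

/-- The right side is the distributional Laplacian tested against a reflected, translated bump; weak
equations and inequalities thereby become pointwise ones for mollifications. -/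
theorem laplacian_mollify {g : E → ℝ} (hg : LocallyIntegrable g μ) (n : ℕ) (x : E) :
    (Δ (mollify μ n g)) x
      = ∫ t, g t * (Δ (fun y => (shrinkingBump E n).normed μ (x - y))) t ∂μ :=
  laplacian_convolution hg (ContDiffBump.contDiff_normed (n := 2) _)
    (shrinkingBump E n).hasCompactSupport_normed x

/-- Errors dominated by a mollification error vanish in the limit against test functions. -/
theorem tendsto_integral_mul_of_abs_le_mollify_sub {g ψ : E → ℝ} (hg : LocallyIntegrable g μ)
    (hψ : Continuous ψ) (hψc : HasCompactSupport ψ) {a : ℕ → E → ℝ}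
    (ha : ∀ n x, |a n x| ≤ |mollify μ n g x - g x|) :
    Tendsto (fun n => ∫ x, a n x * ψ x ∂μ) atTop (𝓝 0) := by
  obtain ⟨C, hC⟩ := hψ.bounded_above_of_compact_support hψc
  set K := tsupport ψ
  have hK : IsCompact K := hψc
  have hlim := (tendsto_setIntegral_abs_mollify_sub hg hK).const_mul C
  rw [mul_zero] at hlim
  refine squeeze_zero_norm (fun n => ?_) hlim
  have hint : IntegrableOn (fun x => C * |mollify μ n g x - g x|) K μ :=
    ((((contDiff_mollify hg n).continuous.locallyIntegrable.sub hg).integrableOn_isCompact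
      hK).abs).const_mul C
  rw [← integral_const_mul, ← integral_indicator hK.measurableSet]
  refine norm_integral_le_of_norm_le (hint.integrable_indicator hK.measurableSet)
    (.of_forall fun x => ?_)
  by_cases hx : x ∈ K
  · rw [indicator_of_mem hx, norm_mul, mul_comm]
    exact mul_le_mul (hC x) (ha n x) (norm_nonneg _) ((norm_nonneg _).trans (hC x))
  · rw [indicator_of_notMem hx, image_eq_zero_of_notMem_tsupport hx]; simp

/-- **Kato's inequality** for a convex `C²` function with slope bounded by one. -/
theorem integral_deriv_mul_le_integral_comp_mul_laplacian {u F : E → ℝ}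
    (hu : LocallyIntegrable u μ) (hF : LocallyIntegrable F μ)
    (hweak : ∀ φ : E → ℝ, ContDiff ℝ ∞ φ → HasCompactSupport φ →
      ∫ x, u x * (Δ φ) x ∂μ = ∫ x, F x * φ x ∂μ)
    {Φ Φ' Φ'' : ℝ → ℝ} (hΦ : ContDiff ℝ 2 Φ) (h1 : ∀ t, HasDerivAt Φ (Φ' t) t)
    (h2 : ∀ t, HasDerivAt Φ' (Φ'' t) t) (h3 : ∀ t, 0 ≤ Φ'' t) (hb : ∀ t, |Φ' t| ≤ 1)
    (hL : ∀ a b, |Φ a - Φ b| ≤ |a - b|) (hΦu : LocallyIntegrable (fun x => Φ (u x)) μ)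
    {φ : E → ℝ} (hφ : ContDiff ℝ ∞ φ) (hφc : HasCompactSupport φ) (hφ0 : ∀ x, 0 ≤ φ x) :
    ∫ x, Φ' (u x) * F x * φ x ∂μ ≤ ∫ x, Φ (u x) * (Δ φ) x ∂μ := by
  have hφ2 : ContDiff ℝ 2 φ := contDiff_infty.1 hφ 2
  have hΦ'c : Continuous Φ' := continuous_iff_continuousAt.2 fun t => (h2 t).continuousAt
  have hΔ : ∀ n x, (Δ (mollify μ n u)) x = mollify μ n F x := fun n x => by
    rw [laplacian_mollify hu, hweak _ (contDiff_shrinkingBump_sub n x)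
      (hasCompactSupport_shrinkingBump_sub n x), mollify_apply]
  have hwn : ∀ n, ContDiff ℝ 2 (mollify μ n u) := contDiff_mollify hu
  have hFn : ∀ n, Continuous (mollify μ n F) := fun n => (contDiff_mollify hF n).continuous
  have hcomp : ∀ n, ContDiff ℝ 2 fun x => Φ (mollify μ n u x) := fun n => hΦ.comp (hwn n)
  have hΦ'n : ∀ n, Continuous fun x => Φ' (mollify μ n u x) := fun n =>
    hΦ'c.comp (hwn n).continuous
  have hineq : ∀ n, ∫ x, Φ' (mollify μ n u x) * mollify μ n F x * φ x ∂μ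
      ≤ ∫ x, Φ (mollify μ n u x) * (Δ φ) x ∂μ := by
    intro n
    rw [integral_mul_laplacian_eq (hcomp n) hφ2 hφc]
    refine integral_mono
      (((hΦ'n n).mul (hFn n)).locallyIntegrable.integrable_mul_of_hasCompactSupport
        hφ.continuous hφc)
      ((hcomp n).continuous_laplacian.locallyIntegrable.integrable_mul_of_hasCompactSupport
        hφ.continuous hφc) fun x => ?_
    refine mul_le_mul_of_nonneg_right ?_ (hφ0 x)
    rw [← hΔ]
    exact mul_laplacian_le_laplacian_comp (hwn n) hΦ h1 h2 h3 x
  have hR : Tendsto (fun n => ∫ x, Φ (mollify μ n u x) * (Δ φ) x ∂μ) atTop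
      (𝓝 (∫ x, Φ (u x) * (Δ φ) x ∂μ)) := by
    have h := tendsto_integral_mul_of_abs_le_mollify_sub hu hφ2.continuous_laplacian hφc.laplacian
      (a := fun n x => Φ (mollify μ n u x) - Φ (u x)) fun n x => hL _ _
    rw [← tendsto_sub_nhds_zero_iff]
    refine h.congr fun n => ?_
    rw [← integral_sub ((hcomp n).continuous.locallyIntegrable.integrable_mul_of_hasCompactSupport
      hφ2.continuous_laplacian hφc.laplacian)
      (hΦu.integrable_mul_of_hasCompactSupport hφ2.continuous_laplacian hφc.laplacian)]
    simp_rw [sub_mul]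
  have hFφ := hF.integrable_mul_of_hasCompactSupport hφ.continuous hφc
  have hmeas : ∀ n, AEStronglyMeasurable (fun x => Φ' (mollify μ n u x) * (F x * φ x)) μ :=
    fun n => (hΦ'n n).aestronglyMeasurable.mul hFφ.aestronglyMeasurable
  have hdom : ∀ n, ∀ᵐ x ∂μ, ‖Φ' (mollify μ n u x) * (F x * φ x)‖ ≤ ‖F x * φ x‖ := fun n =>
    .of_forall fun x => by
      rw [norm_mul]
      exact mul_le_of_le_one_left (norm_nonneg _) (hb _)
  have hD : Tendsto (fun n => ∫ x, Φ' (mollify μ n u x) * (F x * φ x) ∂μ) atTop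
      (𝓝 (∫ x, Φ' (u x) * (F x * φ x) ∂μ)) := by
    refine tendsto_integral_of_dominated_convergence (fun x => ‖F x * φ x‖) hmeas hFφ.norm hdom ?_
    filter_upwards [ae_tendsto_mollify hu] with x hx
    exact ((hΦ'c.tendsto _).comp hx).mul_const _
  -- Split `Φ'(uₙ) Fₙ = Φ'(uₙ) (Fₙ - F) + Φ'(uₙ) F`: the first term tends to zero by local `L¹`
  -- convergence, the second is `hD`.
  have hLft : Tendsto (fun n => ∫ x, Φ' (mollify μ n u x) * mollify μ n F x * φ x ∂μ) atTop
      (𝓝 (∫ x, Φ' (u x) * F x * φ x ∂μ)) := by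
    have h := tendsto_integral_mul_of_abs_le_mollify_sub hF hφ.continuous hφc
      (a := fun n x => Φ' (mollify μ n u x) * (mollify μ n F x - F x)) fun n x => by
        rw [abs_mul]
        exact mul_le_of_le_one_left (abs_nonneg _) (hb _)
    have h' := h.add hD
    rw [zero_add] at h'
    simp_rw [mul_assoc] at h' ⊢
    refine h'.congr fun n => ?_
    rw [← integral_add]
    · refine integral_congr_ae (.of_forall fun x => ?_)
      simp only
      ring
    · have hi := ((hFn n).locallyIntegrable.sub hF).integrable_mul_of_hasCompactSupport
        hφ.continuous hφc (μ := μ)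
      refine hi.mono ((hΦ'n n).aestronglyMeasurable.mul hi.aestronglyMeasurable)
        (.of_forall fun x => ?_)
      rw [norm_mul]
      exact mul_le_of_le_one_left (norm_nonneg _) (hb _)
    · exact hFφ.mono (hmeas n) (hdom n)
  exact le_of_tendsto_of_tendsto' hLft hR hineq

/-- A nonnegative distributional solution of `Δ v ≥ v³` on the whole space vanishes. -/
theorem ae_eq_zero_of_pow_three_le_laplacian {v : E → ℝ} (hv : LocallyIntegrable v μ)
    (hv3 : LocallyIntegrable (fun x => v x ^ 3) μ) (hv0 : ∀ x, 0 ≤ v x)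
    (hweak : ∀ φ : E → ℝ, ContDiff ℝ ∞ φ → HasCompactSupport φ → (∀ x, 0 ≤ φ x) →
      ∫ x, v x ^ 3 * φ x ∂μ ≤ ∫ x, v x * (Δ φ) x ∂μ) :
    ∀ᵐ x ∂μ, v x = 0 := by
  have hz : ∀ n x, mollify μ n v x = 0 := by
    intro n
    refine eq_zero_of_pow_three_le_laplacian (contDiff_mollify hv n) (mollify_nonneg hv0 n)
      fun x => ?_
    rw [laplacian_mollify hv]
    refine le_trans ?_ (hweak _ (contDiff_shrinkingBump_sub n x)
      (hasCompactSupport_shrinkingBump_sub n x) fun t => (shrinkingBump E n).nonneg_normed _)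
    set b := mollify μ n v x with hb
    set ρ : E → ℝ := fun t => (shrinkingBump E n).normed μ (x - t) with hρ
    have hb0 : 0 ≤ b := mollify_nonneg hv0 n x
    have hρ1 : ∫ t, ρ t ∂μ = 1 := by
      rw [hρ, integral_sub_left_eq_self]
      exact (shrinkingBump E n).integral_normed
    have hρi : Integrable ρ μ :=
      (contDiff_shrinkingBump_sub n x).continuous.integrable_of_hasCompactSupport
        (hasCompactSupport_shrinkingBump_sub n x)
    have hvi : Integrable (fun t => v t * ρ t) μ := integrable_mul_shrinkingBump hv n x
    have hbv : ∫ t, v t * ρ t ∂μ = b := rfl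
    -- Jensen's inequality through the tangent line of the cube at the average `b`: `v³ - 3b²v + 2b³
    -- = (v - b)² (v + 2b) ≥ 0`.
    calc b ^ 3 = ∫ t, (3 * b ^ 2 * (v t * ρ t) - 2 * b ^ 3 * ρ t) ∂μ := by
          rw [integral_sub (hvi.const_mul _) (hρi.const_mul _), integral_const_mul,
            integral_const_mul, hbv, hρ1]
          ring
      _ ≤ ∫ t, v t ^ 3 * ρ t ∂μ := by
          refine integral_mono ((hvi.const_mul _).sub (hρi.const_mul _))
            (integrable_mul_shrinkingBump hv3 n x) fun t => ?_
          have h0 : 0 ≤ ρ t := (shrinkingBump E n).nonneg_normed _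
          have h1 : 0 ≤ (v t - b) ^ 2 * (v t + 2 * b) :=
            mul_nonneg (sq_nonneg _) (by linarith [hv0 t])
          have h2 := mul_nonneg h1 h0
          linarith
  filter_upwards [ae_tendsto_mollify hv] with x hx
  simp_rw [hz] at hx
  exact tendsto_nhds_unique hx tendsto_const_nhds

/-- If `Δ u = F` in the sense of distributions and `F ≥ (u - z)³` wherever `u ≥ z`, then
`u ≤ z` almost everywhere. -/
theorem ae_le_of_distributional_laplacian {u F : E → ℝ} {z : ℝ} (hu : LocallyIntegrable u μ)
    (hF : LocallyIntegrable F μ)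
    (hweak : ∀ φ : E → ℝ, ContDiff ℝ ∞ φ → HasCompactSupport φ →
      ∫ x, u x * (Δ φ) x ∂μ = ∫ x, F x * φ x ∂μ)
    (hFu : ∀ x, z ≤ u x → (u x - z) ^ 3 ≤ F x) : ∀ᵐ x ∂μ, u x ≤ z := by
  have huz : LocallyIntegrable (fun x => u x - z) μ := hu.sub (locallyIntegrable_const z)
  have hcont : Continuous softPos := contDiff_softPos.continuous
  have hcont' : Continuous softPosDeriv :=
    continuous_iff_continuousAt.2 fun t => (hasDerivAt_softPosDeriv t).continuousAt
  have hv : LocallyIntegrable (fun x => softPos (u x - z)) μ := by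
    refine huz.mono (hcont.comp_aestronglyMeasurable huz.aestronglyMeasurable)
      (.of_forall fun x => ?_)
    simpa [softPos_of_nonpos le_rfl] using abs_softPos_sub_le (u x - z) 0
  have habs : ∀ t, |softPosDeriv t| ≤ 1 := fun t => by
    rw [abs_of_nonneg (softPosDeriv_nonneg t)]; exact softPosDeriv_le_one t
  have hDF : LocallyIntegrable (fun x => softPosDeriv (u x - z) * F x) μ := by
    refine hF.mono ((hcont'.comp_aestronglyMeasurable huz.aestronglyMeasurable).mul
      hF.aestronglyMeasurable) (.of_forall fun x => ?_)
    rw [norm_mul]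
    exact mul_le_of_le_one_left (norm_nonneg _) (habs _)
  have hle : ∀ x, softPos (u x - z) ^ 3 ≤ softPosDeriv (u x - z) * F x := fun x =>
    softPos_pow_three_le fun h => hFu x (by linarith)
  -- The pointwise inequality `hle` itself supplies an integrable majorant for the cube.
  have hv3 : LocallyIntegrable (fun x => softPos (u x - z) ^ 3) μ := by
    refine hDF.mono (hv.aestronglyMeasurable.pow 3) (.of_forall fun x => ?_)
    rw [Real.norm_of_nonneg (pow_nonneg (softPos_nonneg _) 3)]
    exact (hle x).trans (le_abs_self _)
  have hzero := ae_eq_zero_of_pow_three_le_laplacian hv hv3 (fun x => softPos_nonneg _)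
    fun φ hφ hφc hφ0 => by
      refine le_trans ?_ (integral_deriv_mul_le_integral_comp_mul_laplacian hu hF hweak
        (Φ := fun t => softPos (t - z)) (Φ' := fun t => softPosDeriv (t - z))
        (contDiff_softPos.comp (contDiff_id.sub contDiff_const))
        (fun t => (hasDerivAt_softPos _).comp_sub_const t z)
        (fun t => (hasDerivAt_softPosDeriv _).comp_sub_const t z)
        (fun t => by positivity) (fun t => habs _)
        (fun a b => by simpa using abs_softPos_sub_le (a - z) (b - z)) hv hφ hφc hφ0)
      exact integral_mono (hv3.integrable_mul_of_hasCompactSupport hφ.continuous hφc)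
        (hDF.integrable_mul_of_hasCompactSupport hφ.continuous hφc)
        fun x => mul_le_mul_of_nonneg_right (hle x) (hφ0 x)
  filter_upwards [hzero] with x hx
  by_contra! h
  exact (softPos_pos_and_le (sub_pos.2 h)).1.ne' hx

end Kato

/-! ### Application to the cubic nonlinearity -/

section CahnHilliard

theorem MemLpLoc.locallyIntegrable_pow {N : ℕ} {u : EuclideanSpace ℝ (Fin N) → ℝ}
    {k m : ℕ} (hk : k ≤ m) (hu : MemLpLoc u m) :
    LocallyIntegrable (fun x => u x ^ k) := by
  rw [locallyIntegrable_iff]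
  intro K hK
  have : IsFiniteMeasure (volume.restrict K) := ⟨by simpa using hK.measure_lt_top⟩
  have hmem : MemLp u k (volume.restrict K) := (hu K hK).mono_exponent (by exact_mod_cast hk)
  refine (hmem.integrable_norm_pow').mono (hmem.aestronglyMeasurable.pow k)
    (.of_forall fun x => ?_)
  simp

/-- Above the largest root the cubic `t³ - t + δ` dominates `(t - z)³`. -/
theorem sub_pow_three_le_of_root {δ z t : ℝ} (hz : z ^ 3 - z + δ = 0) (hz3 : 1 / √3 < z)
    (ht : z ≤ t) : (t - z) ^ 3 ≤ t ^ 3 - t + δ := by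
  have hs : (0 : ℝ) < 1 / √3 := by positivity
  have hs2 : (1 / √3) ^ 2 = (1 : ℝ) / 3 := by
    rw [div_pow, Real.sq_sqrt (by norm_num)]; norm_num
  have h1 : 1 / 3 ≤ z ^ 2 := by rw [← hs2]; gcongr
  have h2 : z ^ 2 ≤ t * z := by nlinarith
  -- As `z` is a root, `t³ - t + δ - (t - z)³ = (t - z)(3tz - 1)`, and `3tz ≥ 3z² ≥ 1`.
  have h3 : 0 ≤ (t - z) * (3 * (t * z) - 1) :=
    mul_nonneg (by linarith) (by linarith)
  nlinarith

end CahnHilliard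

end

theorem proposition2p1 (N : ℕ) (δ : ℝ) (hδ : δ ∈ Set.Ioo (-(2 / (3 * √3))) (2 / (3 * √3)))
    (u : EuclideanSpace ℝ (Fin N) → ℝ) (hu : MemLpLoc u 3)
    (hsol : IsDistributionalSolution δ u) :
    ∀ᵐ x, z₁ δ ≤ u x ∧ u x ≤ z₃ δ := by
  obtain ⟨z₂, h1, -, -, h3, hroots⟩ := roots_cahnHilliard δ hδ
  have hz1 : cahnHilliardNonlinearity δ (z₁ δ) = 0 := by
    have : z₁ δ ∈ rootSetCH δ := by rw [hroots]; simp
    exact this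
  have hz3 : cahnHilliardNonlinearity δ (z₃ δ) = 0 := by
    have : z₃ δ ∈ rootSetCH δ := by rw [hroots]; simp
    exact this
  unfold cahnHilliardNonlinearity at hz1 hz3
  have hu1 : LocallyIntegrable u := by
    simpa using hu.locallyIntegrable_pow (k := 1) (m := 3) (by norm_num)
  have hu3 : LocallyIntegrable fun x => u x ^ 3 :=
    hu.locallyIntegrable_pow (k := 3) (m := 3) le_rfl
  have hF : LocallyIntegrable fun x => u x ^ 3 - u x + δ :=
    (hu3.sub hu1).add (locallyIntegrable_const δ)
  have hweak : ∀ φ : EuclideanSpace ℝ (Fin N) → ℝ, ContDiff ℝ ∞ φ → HasCompactSupport φ →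
      ∫ x, u x * (Δ φ) x = ∫ x, (u x ^ 3 - u x + δ) * φ x := by
    intro φ hφ hφc
    rw [← neg_inj, hsol φ hφ hφc, ← integral_neg]
    refine integral_congr_ae (.of_forall fun x => ?_)
    simp only [cahnHilliardNonlinearity]
    ring
  have hupper : ∀ᵐ x, u x ≤ z₃ δ := ae_le_of_distributional_laplacian hu1 hF hweak fun x hx =>
    sub_pow_three_le_of_root (by linarith) h3 hx
  -- The function `-u` has Laplacian `-F`, and `-z₁ δ` is a root of the cubic for `-δ` lying beyond
  -- `1 / √3`.
  have hlower : ∀ᵐ x, (-u) x ≤ -z₁ δ := by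
    refine ae_le_of_distributional_laplacian hu1.neg hF.neg (fun φ hφ hφc => ?_) fun x hx => ?_
    · simp only [Pi.neg_apply, neg_mul]
      rw [integral_neg, integral_neg, hweak φ hφ hφc]
    · refine (sub_pow_three_le_of_root (δ := -δ) (by linarith) (by linarith) hx).trans_eq ?_
      simp only [Pi.neg_apply]
      ring
  filter_upwards [hupper, hlower] with x hx hx'
  exact ⟨neg_le_neg_iff.1 hx', hx⟩
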